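/- Let $\Gamma$ be a group with a given orientation-preserving action by homeomorphisms on the circle $S^1=\mathbb{R}/\mathbb{Z}$. For $g\in\Gamma$ let $F_g\colon\mathbb{R}\to\mathbb{R}$ be the increasing lift of the action of $g$ with $F_g(0)\in[0,1)$, which commutes with $x\mapsto x+1$, and let $c(g,h)\in\{0,1\}$ be the integer with $F_g\circ F_h=F_{gh}+c(g,h)$. The class of the cocycle $c$ in $H^2(\Gamma;\mathbb{Z})$ is the Euler class $\mathrm{eu}$, and the class of $c$ in bounded cohomology $H^2_b(\Gamma;\mathbb{R})$ is the bounded Euler class $\mathrm{eu}_b$. Assume that * $\Gamma$ is finitely presented and $H_1(\Gamma;\mathbb{Z})$ is finite; * every quasi-morphism $\Gamma\to\mathbb{R}$ is trivial, i.e., at bounded distance from a homomorphism; * $H^2_b(\Gamma;\mathbb{R})\cong\mathbb{R}$, generated by $\mathrm{eu}_b$. Let $\widetilde\Gamma$ be the central extension group of $\Gamma$ by $\mathbb{Z}$ with class $\mathrm{eu}$, let $H:=H_2(\Gamma;\mathbb{Z})$, and for an abelian group $A$ with trivial $\Gamma$-action and $\varphi\in H^2(\Gamma;A)$ let $\langle\varphi,\cdot\rangle\colon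 H\to A$ be the evaluation map. Then: 1. The evaluation map $\langle\mathrm{eu},\cdot\rangle\colon H\to\mathbb{Z}$ is non-trivial. 2. Let $m\in\mathbb{N}_{>0}$ be the positive generator of the image of $\langle\mathrm{eu},\cdot\rangle$ and let $\epsilon:=\frac1m\langle\mathrm{eu},\cdot\rangle\colon H\to\mathbb{Z}$. Then there exists a class $\varphi\in H^2(\Gamma;H)$ with $$H^2(\mathrm{id}_\Gamma;\epsilon)(\varphi)=\mathrm{eu}\quad\text{and}\quad\langle\varphi,\cdot\rangle=m\cdot\mathrm{id}_H.$$ 3. For every such $\varphi$, let $E$ be the central extension group of $\Gamma$ by $H$ with class $\varphi$. Then there exists an epimorphism $\psi\colon E\to\widetilde\Gamma$ with $\psi|_H=\epsilon\colon H\to\mathbb{Z}$ and $\ker\psi\subset H$. -/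

import Mathlib

noncomputable section

namespace EulerExt

/-! ### Integral homology, cohomology with trivial coefficients, and evaluation -/

/-- The abelian group `M` with the trivial action of `Γ`. -/
abbrev triv (Γ : Type) [Group Γ] (M : Type) [AddCommGroup M] : Rep ℤ Γ := Rep.trivial ℤ Γ M

/-- `H_1(Γ; ℤ)`. -/
abbrev H₁ (Γ : Type) [Group Γ] : ModuleCat ℤ := groupHomology.H1 (triv Γ ℤ)

/-- `H_2(Γ; ℤ)`. -/
abbrev H₂ (Γ : Type) [Group Γ] : ModuleCat ℤ := groupHomology.H2 (triv Γ ℤ)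

/-- `H^2(Γ; M)`, where `Γ` acts trivially on the abelian group `M`. -/
abbrev Hup₂ (Γ : Type) [Group Γ] (M : Type) [AddCommGroup M] : ModuleCat ℤ :=
  groupCohomology.H2 (triv Γ M)

section Evaluation

variable {Γ : Type} [Group Γ] {M : Type} [AddCommGroup M]

/-- The map `H^2(id_Γ; f) : H^2(Γ; M) → H^2(Γ; N)` induced by a homomorphism of coefficients. -/
def coeffMap {N : Type} [AddCommGroup N] (f : M →+ N) : Hup₂ Γ M →+ Hup₂ Γ N :=
  ((groupCohomology.functor ℤ Γ 2).map
    ((Rep.trivialFunctor ℤ Γ).map (ModuleCat.ofHom f.toIntLinearMap))).hom.toAddMonoidHom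

/-- The pairing of `2`-cochains with `2`-chains: `⟨c, ∑ nᵢ (gᵢ, hᵢ)⟩ = ∑ nᵢ c(gᵢ, hᵢ)`. -/
def chainPairing {Γ M : Type} [AddCommGroup M] : (Γ × Γ → M) →+ (Γ × Γ →₀ ℤ) →+ M :=
  AddMonoidHom.mk' (fun c => AddMonoidHom.mk' (fun z : Γ × Γ →₀ ℤ => z.sum fun p n => n • c p)
      fun z z' => Finsupp.sum_add_index' (by simp) (by simp [add_smul]))
    fun c c' => by ext; simp

lemma chainPairing_single {Γ M : Type} [AddCommGroup M] (c : Γ × Γ → M) (p : Γ × Γ) (n : ℤ) :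
    chainPairing c (Finsupp.single p n) = n • c p := by
  simp [chainPairing]

lemma chainPairing_boundary (c : groupCohomology.cocycles₂ (triv Γ M))
    (w : Γ × Γ × Γ →₀ ℤ) :
    chainPairing (c : Γ × Γ → M) (groupHomology.d₃₂ (triv Γ ℤ) w) = 0 := by
  induction w using Finsupp.induction_linear with
  | zero => simp only [map_zero]
  | add x y hx hy => rw [map_add, map_add, hx, hy, add_zero]
  | single p n =>
    obtain ⟨g, h, k⟩ := p
    have hc := (groupCohomology.mem_cocycles₂_def c.1).1 c.2 g h k
    change c (h, k) - c (g * h, k) + c (g, h * k) - c (g, h) = 0 at hc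
    rw [groupHomology.d₃₂_single]
    change chainPairing (c : Γ × Γ → M) (Finsupp.single (h, k) n - Finsupp.single (g * h, k) n +
      Finsupp.single (g, h * k) n - Finsupp.single (g, h) n) = 0
    simp only [map_sub, map_add, chainPairing_single]
    rw [← smul_sub, ← smul_add, ← smul_sub, hc, smul_zero]

lemma chainPairing_coboundary (u : Γ → M)
    (z : groupHomology.cycles₂ (triv Γ ℤ)) :
    chainPairing (groupCohomology.d₁₂ (triv Γ M) u : Γ × Γ → M) z.1 = 0 := by
  have key : ∀ y : Γ × Γ →₀ ℤ,
      chainPairing (groupCohomology.d₁₂ (triv Γ M) u : Γ × Γ → M) y =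
        Finsupp.linearCombination ℤ u (groupHomology.d₂₁ (triv Γ ℤ) y) := by
    intro y
    induction y using Finsupp.induction_linear with
    | zero => simp only [map_zero]
    | add x y hx hy => rw [map_add, map_add, map_add, hx, hy]
    | single p n =>
      obtain ⟨g, h⟩ := p
      rw [groupHomology.d₂₁_single, chainPairing_single]
      change n • (u h - u (g * h) + u g) = Finsupp.linearCombination ℤ u
        (Finsupp.single h n - Finsupp.single (g * h) n + Finsupp.single g n)
      simp [smul_sub, smul_add]
  have hz : groupHomology.d₂₁ (triv Γ ℤ) z.1 = 0 := z.2
  rw [key, hz, map_zero]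

/-- The unique homomorphism `Y → Z` through which `f` factors, if `p : X → Y` is onto and
`ker p ≤ ker f`. -/
def descend {X Y Z : Type} [AddCommGroup X] [AddCommGroup Y] [AddCommGroup Z]
    (p : X →+ Y) (hp : Function.Surjective p) (f : X →+ Z) (h : p.ker ≤ f.ker) : Y →+ Z :=
  p.liftOfSurjective hp ⟨f, h⟩

lemma descend_apply {X Y Z : Type} [AddCommGroup X] [AddCommGroup Y] [AddCommGroup Z]
    (p : X →+ Y) (hp : Function.Surjective p) (f : X →+ Z) (h : p.ker ≤ f.ker) (x : X) :
    descend p hp f h (p x) = f x :=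
  p.liftOfRightInverse_comp_apply _ (Function.rightInverse_surjInv hp) ⟨f, h⟩ x

lemma homologyπ_surjective :
    Function.Surjective (groupHomology.H2π (triv Γ ℤ)).hom :=
  (ModuleCat.epi_iff_surjective _).1 inferInstance

lemma cohomologyπ_surjective :
    Function.Surjective (groupCohomology.H2π (triv Γ M)).hom :=
  (ModuleCat.epi_iff_surjective _).1 inferInstance

/-- Evaluation of a cocycle on homology classes. -/
def evalCocycle : groupCohomology.cocycles₂ (triv Γ M) →+ (H₂ Γ →+ M) :=
  AddMonoidHom.mk' (fun c =>
    descend (groupHomology.H2π (triv Γ ℤ)).hom.toAddMonoidHom homologyπ_surjective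
      ((chainPairing (c : Γ × Γ → M)).comp
        (groupHomology.cycles₂ (triv Γ ℤ)).subtype.toAddMonoidHom)
      (by
        intro z hz
        obtain ⟨w, hw⟩ := (groupHomology.H2π_eq_zero_iff z).1 hz
        change chainPairing (c : Γ × Γ → M) z.1 = 0
        rw [← hw]
        exact chainPairing_boundary c w))
    (by
      intro c c'
      ext x
      obtain ⟨z, rfl⟩ := homologyπ_surjective x
      refine (descend_apply _ _ _ _ z).trans ?_
      refine (DFunLike.congr_fun (map_add chainPairing c.1 c'.1) z.1).trans ?_
      refine congrArg₂ (fun a b : M => a + b) (Eq.symm ?_) (Eq.symm ?_)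
      · exact descend_apply _ _ _ _ z
      · exact descend_apply _ _ _ _ z)

lemma evalCocycle_apply (c : groupCohomology.cocycles₂ (triv Γ M))
    (z : groupHomology.cycles₂ (triv Γ ℤ)) :
    evalCocycle c (groupHomology.H2π (triv Γ ℤ) z) = chainPairing (c : Γ × Γ → M) z.1 :=
  descend_apply _ _ _ _ z

/-- The evaluation `φ ↦ ⟨φ, ·⟩`, `H^2(Γ; M) → Hom(H_2(Γ; ℤ), M)`. -/
def kroneckerEval : Hup₂ Γ M →+ (H₂ Γ →+ M) :=
  descend (groupCohomology.H2π (triv Γ M)).hom.toAddMonoidHom cohomologyπ_surjective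
    evalCocycle
    (by
      intro c hc
      obtain ⟨u, hu⟩ := (groupCohomology.H2π_eq_zero_iff c).1 hc
      rw [AddMonoidHom.mem_ker]
      ext x
      obtain ⟨z, rfl⟩ := homologyπ_surjective x
      refine (evalCocycle_apply c z).trans ?_
      rw [← hu]
      exact chainPairing_coboundary u z)

/-- Evaluation is computed on representatives. -/
lemma kroneckerEval_apply (c : groupCohomology.cocycles₂ (triv Γ M))
    (z : groupHomology.cycles₂ (triv Γ ℤ)) :
    kroneckerEval (groupCohomology.H2π (triv Γ M) c)
      (groupHomology.H2π (triv Γ ℤ) z) = z.1.sum fun p n => n • (c p : M) :=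
  (DFunLike.congr_fun (descend_apply _ _ _ _ c) _).trans (evalCocycle_apply c z)

end Evaluation

/-! ### Central extensions and their classes -/

/-- The extension `1 → M → E → Γ → 1` is central, and `φ ∈ H^2(Γ; M)` is its class: some
set-theoretic section `s` satisfies `s(g) s(h) = c(g, h) s(gh)` with a cocycle `c` in the
class `φ`. -/
def HasClass {Γ : Type} [Group Γ] {M : Type} [AddCommGroup M]
    {E : Type*} [Group E] (S : GroupExtension (Multiplicative M) E Γ) (φ : Hup₂ Γ M) : Prop :=
  S.inl.range ≤ Subgroup.center E ∧
    ∃ (s : S.Section) (c : groupCohomology.cocycles₂ (triv Γ M)),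
      groupCohomology.H2π (triv Γ M) c = φ ∧
      ∀ g h : Γ, s g * s h = S.inl (Multiplicative.ofAdd (c (g, h))) * s (g * h)

/-- Every class in `H^2(Γ; M)` is the class of a central extension. -/
lemma exists_hasClass {Γ : Type} [Group Γ] {M : Type} [AddCommGroup M] (φ : Hup₂ Γ M) :
    ∃ (E : Type) (_ : Group E) (S : GroupExtension (Multiplicative M) E Γ), HasClass S φ := by
  obtain ⟨c, rfl⟩ := cohomologyπ_surjective φ
  let f : Γ → Γ → M := fun g h => c (g, h)
  have hf : ∀ g h k, f (g * h) k + f g h = f h k + f g (h * k) :=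
    fun g h k => (groupCohomology.mem_cocycles₂_iff c.1).1 c.2 g h k
  have h1 : ∀ g, f 1 g = f 1 1 := fun g => by
    have := hf 1 1 g
    simp only [one_mul] at this
    exact (add_left_cancel this).symm
  have h2 : ∀ g, f g 1 = f 1 1 := fun g => by
    have := hf g 1 1
    simp only [mul_one] at this
    exact add_right_cancel this
  let G : Group (M × Γ) := @Group.ofLeftAxioms (M × Γ)
    ⟨fun x y => (x.1 + y.1 + f x.2 y.2, x.2 * y.2)⟩
    ⟨fun x => (-x.1 - f x.2⁻¹ x.2 - f 1 1, x.2⁻¹)⟩ ⟨(-f 1 1, 1)⟩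
    (fun x y z => Prod.ext
      (by
        change x.1 + y.1 + f x.2 y.2 + z.1 + f (x.2 * y.2) z.2 =
          x.1 + (y.1 + z.1 + f y.2 z.2) + f x.2 (y.2 * z.2)
        have := hf x.2 y.2 z.2
        calc _ = x.1 + y.1 + z.1 + (f (x.2 * y.2) z.2 + f x.2 y.2) := by abel
          _ = _ := by rw [this]; abel) (mul_assoc _ _ _))
    (fun x => Prod.ext (by change -f 1 1 + x.1 + f 1 x.2 = x.1; rw [h1 x.2]; abel) (one_mul _))
    (fun x => Prod.ext
      (by change -x.1 - f x.2⁻¹ x.2 - f 1 1 + x.1 + f x.2⁻¹ x.2 = -f 1 1; abel)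
      (inv_mul_cancel _))
  have mulDef : ∀ x y : M × Γ, x * y = (x.1 + y.1 + f x.2 y.2, x.2 * y.2) := fun _ _ => rfl
  have oneDef : (1 : M × Γ) = (-f 1 1, 1) := rfl
  let i : Multiplicative M →* M × Γ := MonoidHom.mk' (fun a => (a.toAdd - f 1 1, 1)) fun a b => by
    rw [mulDef]
    exact Prod.ext (by simp only [toAdd_mul]; abel) (one_mul 1).symm
  let r : M × Γ →* Γ := MonoidHom.mk' (fun x => x.2) fun _ _ => rfl
  let S : GroupExtension (Multiplicative M) (M × Γ) Γ :=
    { inl := i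
      rightHom := r
      inl_injective := fun a b h => by
        have : a.toAdd - f 1 1 = b.toAdd - f 1 1 := congrArg Prod.fst h
        exact Multiplicative.toAdd.injective (sub_left_injective this)
      range_inl_eq_ker_rightHom := by
        ext x
        constructor
        · rintro ⟨a, rfl⟩
          rfl
        · intro hx
          have hx : x.2 = 1 := hx
          exact ⟨Multiplicative.ofAdd (x.1 + f 1 1),
            Prod.ext (add_sub_cancel_right x.1 (f 1 1)) hx.symm⟩
      rightHom_surjective := fun g => ⟨(0, g), rfl⟩ }
  refine ⟨M × Γ, G, S, ?_, ⟨fun g => (0, g), fun g => rfl⟩, c, rfl, fun g h => ?_⟩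
  · rintro _ ⟨a, rfl⟩
    rw [Subgroup.mem_center_iff]
    intro x
    refine Prod.ext ?_ ((mul_one x.2).trans (one_mul x.2).symm)
    change x.1 + (a.toAdd - f 1 1) + f x.2 1 = a.toAdd - f 1 1 + x.1 + f 1 x.2
    rw [h1 x.2, h2 x.2]; abel
  · refine Prod.ext ?_ (one_mul _).symm
    change 0 + 0 + f g h = f g h - f 1 1 + 0 + f 1 (g * h)
    rw [h1 (g * h)]; abel

/-! ### Quasi-morphisms and bounded cohomology in degree two -/

/-- A quasi-morphism is a function `f : Γ → ℝ` with `sup |f(gh) - f(g) - f(h)| < ∞`. -/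
def IsQuasimorphism {Γ : Type} [Group Γ] (f : Γ → ℝ) : Prop :=
  ∃ D : ℝ, ∀ g h : Γ, |f (g * h) - f g - f h| ≤ D

/-- A quasi-morphism is trivial if it is at bounded distance from a homomorphism. -/
def IsTrivialQuasimorphism {Γ : Type} [Group Γ] (f : Γ → ℝ) : Prop :=
  ∃ (χ : Γ →* Multiplicative ℝ) (D : ℝ), ∀ g : Γ, |f g - (χ g).toAdd| ≤ D

/-- The bounded real-valued functions on `X`. -/
def boundedFun (X : Type) : Submodule ℝ (X → ℝ) where
  carrier := {f | ∃ D : ℝ, ∀ x, |f x| ≤ D}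
  zero_mem' := ⟨0, by simp⟩
  add_mem' := by
    rintro f g ⟨D, hD⟩ ⟨D', hD'⟩
    exact ⟨D + D', fun x => (abs_add_le _ _).trans (add_le_add (hD x) (hD' x))⟩
  smul_mem' := by
    rintro a f ⟨D, hD⟩
    refine ⟨|a| * D, fun x => ?_⟩
    rw [Pi.smul_apply, smul_eq_mul, abs_mul]
    exact mul_le_mul_of_nonneg_left (hD x) (abs_nonneg a)

/-- Bounded inhomogeneous real `2`-cocycles. -/
def boundedCocycles (Γ : Type) [Group Γ] : Submodule ℝ (Γ × Γ → ℝ) :=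
  groupCohomology.cocycles₂ (Rep.trivial ℝ Γ ℝ) ⊓ boundedFun (Γ × Γ)

/-- Coboundaries of bounded real `1`-cochains. -/
def boundedCoboundaries (Γ : Type) [Group Γ] : Submodule ℝ (Γ × Γ → ℝ) :=
  (boundedFun Γ).map (groupCohomology.d₁₂ (Rep.trivial ℝ Γ ℝ)).hom

/-- Bounded cohomology `H^2_b(Γ; ℝ)`. -/
abbrev Hb₂ (Γ : Type) [Group Γ] : Type :=
  boundedCocycles Γ ⧸ (boundedCoboundaries Γ).submoduleOf (boundedCocycles Γ)

/-! ### Circle actions and the Euler class -/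

/-- `F : ℝ → ℝ` is a continuous non-decreasing lift, commuting with `x ↦ x + 1`, of the
self-homeomorphism `f` of the circle `ℝ / ℤ`. -/
def IsLift (F : CircleDeg1Lift) (f : UnitAddCircle ≃ₜ UnitAddCircle) : Prop :=
  Continuous F ∧ ∀ x : ℝ, ((F x : ℝ) : UnitAddCircle) = f (x : UnitAddCircle)

/-- A homeomorphism of the circle preserves the orientation if it has a lift to `ℝ` that is
increasing and commutes with `x ↦ x + 1`. -/
def OrientationPreserving (f : UnitAddCircle ≃ₜ UnitAddCircle) : Prop :=
  ∃ F : CircleDeg1Lift, IsLift F f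

lemma OrientationPreserving.exists_normalized {f : UnitAddCircle ≃ₜ UnitAddCircle}
    (hf : OrientationPreserving f) :
    ∃ F : CircleDeg1Lift, IsLift F f ∧ F 0 ∈ Set.Ico (0 : ℝ) 1 := by
  obtain ⟨F, hF, hF'⟩ := hf
  refine ⟨CircleDeg1Lift.translate (Multiplicative.ofAdd (-(⌊F 0⌋ : ℝ))) * F, ⟨?_, ?_⟩, ?_⟩
  · simp only [CircleDeg1Lift.coe_mul]
    have : Continuous fun x => -(⌊F 0⌋ : ℝ) + F x := by fun_prop
    simpa [Function.comp_def] using this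
  · intro x
    rw [← hF' x]
    simp only [CircleDeg1Lift.mul_apply, CircleDeg1Lift.translate_apply]
    rw [AddCircle.coe_add, ← Int.cast_neg]
    have : ((((-⌊F 0⌋ : ℤ) : ℝ)) : UnitAddCircle) = 0 := by
      rw [AddCircle.coe_eq_zero_iff]; exact ⟨-⌊F 0⌋, by simp⟩
    rw [this, zero_add]
  · simp only [CircleDeg1Lift.mul_apply, CircleDeg1Lift.translate_apply, Set.mem_Ico]
    constructor
    · linarith [Int.floor_le (F 0)]
    · linarith [Int.lt_floor_add_one (F 0)]

/-- Two lifts of the same homeomorphism differ by an integer. -/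
lemma IsLift.exists_int {F F' : CircleDeg1Lift} {f : UnitAddCircle ≃ₜ UnitAddCircle}
    (hF : IsLift F f) (hF' : IsLift F' f) : ∃ n : ℤ, ∀ x, F x = F' x + n := by
  have key : ∀ x, ∃ n : ℤ, (n : ℝ) = F x - F' x := fun x => by
    have h : (((F x - F' x : ℝ)) : UnitAddCircle) = 0 := by
      rw [AddCircle.coe_sub, hF.2, hF'.2, sub_self]
    obtain ⟨n, hn⟩ := (AddCircle.coe_eq_zero_iff (1 : ℝ)).1 h
    exact ⟨n, by simpa using hn⟩
  choose n hn using key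
  have hc : Continuous n := by
    refine Int.isClosedEmbedding_coe_real.isEmbedding.continuous_iff.2 ?_
    have : ((fun k : ℤ => (k : ℝ)) ∘ n) = fun x => F x - F' x := funext hn
    exact this ▸ hF.1.sub hF'.1
  refine ⟨n 0, fun x => ?_⟩
  have h0 : n x = n 0 := PreconnectedSpace.constant inferInstance hc
  linarith [hn x, congrArg (fun k : ℤ => (k : ℝ)) h0]

lemma IsLift.mul {F F' : CircleDeg1Lift} {f f' : UnitAddCircle ≃ₜ UnitAddCircle}
    (hF : IsLift F f) (hF' : IsLift F' f') : IsLift (F * F') (f * f') := by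
  refine ⟨?_, fun x => ?_⟩
  · rw [CircleDeg1Lift.coe_mul]; exact hF.1.comp hF'.1
  · rw [CircleDeg1Lift.mul_apply, hF.2, hF'.2]; rfl

section Euler

variable {Γ : Type} [Group Γ] (ρ : Γ →* (UnitAddCircle ≃ₜ UnitAddCircle))
  (hρ : ∀ g, OrientationPreserving (ρ g))

/-- The lift `F_g` of the action of `g` with `0 ≤ F_g(0) < 1`. -/
def lift (g : Γ) : CircleDeg1Lift := (hρ g).exists_normalized.choose

lemma lift_isLift (g : Γ) : IsLift (lift ρ hρ g) (ρ g) :=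
  (hρ g).exists_normalized.choose_spec.1

lemma lift_zero_mem (g : Γ) : lift ρ hρ g 0 ∈ Set.Ico (0 : ℝ) 1 :=
  (hρ g).exists_normalized.choose_spec.2

/-- The integer `c(g, h)` with `F_g ∘ F_h = F_{gh} + c(g, h)`. -/
def eulerFun (p : Γ × Γ) : ℤ := ⌊lift ρ hρ p.1 (lift ρ hρ p.2 0)⌋

lemma lift_lift (g h : Γ) (x : ℝ) :
    lift ρ hρ g (lift ρ hρ h x) = lift ρ hρ (g * h) x + eulerFun ρ hρ (g, h) := by
  have hgh : IsLift (lift ρ hρ g * lift ρ hρ h) (ρ (g * h)) := by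
    rw [map_mul]; exact (lift_isLift ρ hρ g).mul (lift_isLift ρ hρ h)
  obtain ⟨n, hn⟩ := hgh.exists_int (lift_isLift ρ hρ (g * h))
  have h0 : eulerFun ρ hρ (g, h) = n := by
    have h1 := hn 0
    rw [CircleDeg1Lift.mul_apply] at h1
    have h2 := lift_zero_mem ρ hρ (g * h)
    rw [eulerFun, Int.floor_eq_iff]
    constructor <;> simp only [h1] <;> linarith [h2.1, h2.2]
  rw [h0, ← hn x, CircleDeg1Lift.mul_apply]

lemma eulerFun_cocycle (g h k : Γ) :
    eulerFun ρ hρ (g * h, k) + eulerFun ρ hρ (g, h) =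
      eulerFun ρ hρ (h, k) + eulerFun ρ hρ (g, h * k) := by
  have h1 := lift_lift ρ hρ g h (lift ρ hρ k 0)
  rw [lift_lift ρ hρ h k, lift_lift ρ hρ (g * h) k, CircleDeg1Lift.map_add_int,
    lift_lift ρ hρ g (h * k), mul_assoc] at h1
  have h2 : ((eulerFun ρ hρ (g * h, k) + eulerFun ρ hρ (g, h) : ℤ) : ℝ) =
      (eulerFun ρ hρ (h, k) + eulerFun ρ hρ (g, h * k) : ℤ) := by
    push_cast; linarith
  exact_mod_cast h2

lemma eulerFun_mem (p : Γ × Γ) : 0 ≤ eulerFun ρ hρ p ∧ eulerFun ρ hρ p ≤ 1 := by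
  have h1 := lift_zero_mem ρ hρ p.1
  have h2 := lift_zero_mem ρ hρ p.2
  have h3 : lift ρ hρ p.1 0 ≤ lift ρ hρ p.1 (lift ρ hρ p.2 0) :=
    (lift ρ hρ p.1).monotone h2.1
  have h4 : lift ρ hρ p.1 (lift ρ hρ p.2 0) ≤ lift ρ hρ p.1 (0 + 1) :=
    (lift ρ hρ p.1).monotone (by linarith [h2.2])
  rw [CircleDeg1Lift.map_add_one] at h4
  constructor
  · exact Int.floor_nonneg.2 (h1.1.trans h3)
  · refine Int.lt_add_one_iff.1 (Int.floor_lt.2 ?_)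
    push_cast; linarith [h1.2]

/-- The Euler cocycle. -/
def eulerCocycle : groupCohomology.cocycles₂ (triv Γ ℤ) :=
  ⟨eulerFun ρ hρ, (groupCohomology.mem_cocycles₂_iff _).2 (eulerFun_cocycle ρ hρ)⟩

/-- The integral Euler class in `H^2(Γ; ℤ)`. -/
def eulerClass : Hup₂ Γ ℤ := groupCohomology.H2π (triv Γ ℤ) (eulerCocycle ρ hρ)

/-- The Euler cocycle as a bounded real cocycle. -/
def boundedEulerCocycle : boundedCocycles Γ :=
  ⟨fun p => (eulerFun ρ hρ p : ℝ),
    (groupCohomology.mem_cocycles₂_iff (A := Rep.trivial ℝ Γ ℝ) _).2 fun g h k => by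
      have := eulerFun_cocycle ρ hρ g h k
      change ((eulerFun ρ hρ (g * h, k) : ℝ) + eulerFun ρ hρ (g, h) =
        eulerFun ρ hρ (h, k) + eulerFun ρ hρ (g, h * k))
      exact_mod_cast this,
    1, fun p => by
      have := eulerFun_mem ρ hρ p
      have h0 : (0 : ℝ) ≤ eulerFun ρ hρ p := by exact_mod_cast this.1
      have h1 : (eulerFun ρ hρ p : ℝ) ≤ 1 := by exact_mod_cast this.2
      exact abs_le.2 ⟨by linarith, h1⟩⟩

/-- The bounded real Euler class in `H^2_b(Γ; ℝ)`. -/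
def boundedEulerClass : Hb₂ Γ := Submodule.Quotient.mk (boundedEulerCocycle ρ hρ)

end Euler

end EulerExt

end

open EulerExt

/-! Non-triviality of the evaluation: `ℝ` is divisible, so a real cocycle that vanishes on all
`2`-cycles is a coboundary `du`. If `eu` evaluated to zero, this would apply to the Euler cocycle;
as that cocycle is bounded, `u` would be a quasi-morphism. Subtracting a nearby homomorphism leaves
`du` unchanged and makes the primitive bounded, so `eu_b = 0`, which is impossible for a generator
of a line (`kroneckerEval_eulerClass_ne_zero`).

Existence of `φ`: finiteness of `H_1` makes the `2`-cycles a direct summand of the `2`-chains, so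
every homomorphism on `H_2` is an evaluation (`kroneckerEval_surjective`). A class evaluating to `m
· id` may have the wrong image under `ε`, but the error evaluates to zero; since `ε` is split, the
error can be pushed back along a section and subtracted (`exists_coeffMap_eq_and_kroneckerEval_eq`).

The epimorphism: a coefficient map matching the classes of two central extensions induces a
homomorphism over `Γ` (`exists_extension_hom`). It is onto because `ε` is, and its kernel lies in
`H` because it covers the identity of `Γ`. -/

namespace EulerExt

/-! ### Linear algebra over a principal ideal domain -/

/-- Over a principal ideal domain, the kernel of a surjection from a projective module onto a
finitely generated module is projective. -/
theorem projective_ker_of_surjective_of_finite {R M Q : Type*} [CommRing R] [IsDomain R]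
    [IsPrincipalIdealRing R] [AddCommGroup M] [Module R M] [Module.Projective R M]
    [AddCommGroup Q] [Module R Q] [Module.Finite R Q] (f : M →ₗ[R] Q)
    (hf : Function.Surjective f) : Module.Projective R (LinearMap.ker f) := by
  obtain ⟨n, q, hq⟩ := Module.Finite.exists_fin' R Q
  obtain ⟨a, ha⟩ := Module.projective_lifting_property f q hf
  obtain ⟨b, hb⟩ := Module.projective_lifting_property q f hq
  have ha' : ∀ x, f (a x) = q x := fun x => LinearMap.congr_fun ha x
  have hb' : ∀ x, q (b x) = f x := fun x => LinearMap.congr_fun hb x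
  -- As in Schanuel's lemma, `ker f` is a retract of `M × ker q`. The latter is projective, since
  -- `ker q` is a submodule of `R^n` and hence free.
  let i : LinearMap.ker f →ₗ[R] M × LinearMap.ker q :=
    (LinearMap.ker f).subtype.prod ((b.comp (LinearMap.ker f).subtype).codRestrict _ fun x => by
      simp [hb'])
  let r : M × LinearMap.ker q →ₗ[R] LinearMap.ker f :=
    ((LinearMap.id - a.comp b).coprod (a.comp (LinearMap.ker q).subtype)).codRestrict _ fun x => by
      simp [ha', hb']
  refine Module.Projective.of_split i r (LinearMap.ext fun x => Subtype.ext ?_)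
  change (x : M) - a (b x) + a (b x) = x
  exact sub_add_cancel _ _

/-! ### Universal coefficients in degree two -/

section UniversalCoefficients

variable {Γ : Type} [Group Γ] {M : Type} [AddCommGroup M]

/-- The map sending a `1`-chain with trivial coefficients to its homology class. -/
noncomputable def chainClass (Γ : Type) [Group Γ] : (Γ →₀ ℤ) →ₗ[ℤ] H₁ Γ :=
  (groupHomology.H1π (triv Γ ℤ)).hom ∘ₗ
    (groupHomology.cycles₁IsoOfIsTrivial (triv Γ ℤ)).inv.hom

lemma chainClass_surjective : Function.Surjective (chainClass Γ) := by
  intro x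
  induction x using groupHomology.H1_induction_on with
  | h y => exact ⟨y.1, rfl⟩

/-- Exhibits the `1`-boundaries as the kernel of a surjection from a free module onto `H_1`, the
form in which their projectivity can be deduced. -/
lemma ker_chainClass :
    LinearMap.ker (chainClass Γ) = LinearMap.range (groupHomology.d₂₁ (triv Γ ℤ)).hom := by
  ext x
  exact groupHomology.H1π_eq_zero_iff
    ((groupHomology.cycles₁IsoOfIsTrivial (triv Γ ℤ)).inv x)

/-- If `H_1(Γ; ℤ)` is finitely generated, the `2`-cycles are a direct summand of the `2`-chains. -/
lemma exists_retraction_cycles₂ [Module.Finite ℤ (H₁ Γ)] :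
    ∃ r : (Γ × Γ →₀ ℤ) →ₗ[ℤ] groupHomology.cycles₂ (triv Γ ℤ),
      ∀ z : groupHomology.cycles₂ (triv Γ ℤ), r z.1 = z := by
  let d : (Γ × Γ →₀ ℤ) →ₗ[ℤ] (Γ →₀ ℤ) := (groupHomology.d₂₁ (triv Γ ℤ)).hom
  have hproj : Module.Projective ℤ (LinearMap.range d) := by
    have := projective_ker_of_surjective_of_finite (chainClass Γ) chainClass_surjective
    rwa [ker_chainClass] at this
  -- The boundary map onto its projective image splits by `σ`, and `id - σ ∘ d` projects the chains
  -- onto the cycles.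
  obtain ⟨σ, hσ⟩ := Module.projective_lifting_property d.rangeRestrict LinearMap.id
    d.surjective_rangeRestrict
  have hσ' : ∀ y, d (σ y) = y := fun y => congrArg Subtype.val (LinearMap.congr_fun hσ y)
  let r : (Γ × Γ →₀ ℤ) →ₗ[ℤ] (Γ × Γ →₀ ℤ) := LinearMap.id - σ ∘ₗ d.rangeRestrict
  have hr : ∀ y, r y ∈ LinearMap.ker d := fun y => by
    change d (y - σ (d.rangeRestrict y)) = 0
    rw [map_sub, hσ']
    exact sub_self _
  refine ⟨r.codRestrict (LinearMap.ker d) hr, ?_⟩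
  rintro ⟨z, hz⟩
  have h0 : d.rangeRestrict z = 0 := Subtype.ext hz
  refine Subtype.ext ?_
  change z - σ (d.rangeRestrict z) = z
  rw [h0, map_zero, sub_zero]

/-- A homomorphism on `2`-chains is the pairing with its restriction to the basis. -/
lemma chainPairing_single_one {Γ M : Type} [AddCommGroup M] (F : (Γ × Γ →₀ ℤ) →+ M) (z : Γ × Γ →₀ ℤ) :
    chainPairing (fun p => F (Finsupp.single p 1)) z = F z := by
  induction z using Finsupp.induction_linear with
  | zero => simp only [map_zero]
  | add x y hx hy => rw [map_add, map_add, hx, hy]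
  | single p n =>
    rw [chainPairing_single, ← map_zsmul, Finsupp.smul_single, smul_eq_mul, mul_one]

/-- Pairing with the boundary of the basis chain `(g, h, k)` is exactly the cocycle identity at that
triple. -/
lemma mem_cocycles₂_of_vanishing (c : Γ × Γ → M)
    (hc : ∀ w, chainPairing c (groupHomology.d₃₂ (triv Γ ℤ) w) = 0) :
    c ∈ groupCohomology.cocycles₂ (triv Γ M) := by
  refine (groupCohomology.mem_cocycles₂_def (A := triv Γ M) c).2 fun g h k => ?_
  have := hc (Finsupp.single (g, h, k) 1)
  rw [groupHomology.d₃₂_single] at this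
  change chainPairing c (Finsupp.single (h, k) 1 - Finsupp.single (g * h, k) 1 +
      Finsupp.single (g, h * k) 1 - Finsupp.single (g, h) 1) = 0 at this
  simp only [map_sub, map_add, chainPairing_single, one_smul] at this
  exact this

/-- Surjectivity in the universal coefficient theorem. -/
theorem kroneckerEval_surjective [Module.Finite ℤ (H₁ Γ)] :
    Function.Surjective (kroneckerEval : Hup₂ Γ M →+ (H₂ Γ →+ M)) := by
  intro θ
  obtain ⟨r, hr⟩ := exists_retraction_cycles₂ (Γ := Γ)
  -- The retraction extends `θ` from cycles to all chains; the values on basis elements form the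
  -- desired cocycle.
  let F : (Γ × Γ →₀ ℤ) →+ M :=
    θ.comp ((groupHomology.H2π (triv Γ ℤ)).hom ∘ₗ r).toAddMonoidHom
  have hF : ∀ z : groupHomology.cycles₂ (triv Γ ℤ),
      F z.1 = θ (groupHomology.H2π (triv Γ ℤ) z) := fun z =>
    congrArg (fun y => θ (groupHomology.H2π (triv Γ ℤ) y)) (hr z)
  have hc := mem_cocycles₂_of_vanishing (fun p => F (Finsupp.single p 1)) fun w => by
    have hw : groupHomology.d₃₂ (triv Γ ℤ) w ∈ groupHomology.cycles₂ (triv Γ ℤ) :=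
      groupHomology.d₃₂_comp_d₂₁_apply (triv Γ ℤ) w
    rw [chainPairing_single_one]
    refine (hF ⟨_, hw⟩).trans ?_
    rw [(groupHomology.H2π_eq_zero_iff (A := triv Γ ℤ) ⟨_, hw⟩).2 ⟨w, rfl⟩, map_zero]
  refine ⟨groupCohomology.H2π (triv Γ M) ⟨_, hc⟩, ?_⟩
  ext x
  obtain ⟨z, rfl⟩ := homologyπ_surjective x
  refine (kroneckerEval_apply _ z).trans ?_
  exact (chainPairing_single_one F z.1).trans (hF z)

/-- A real-valued function on `2`-chains that vanishes on cycles is a coboundary. -/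
lemma exists_eq_coboundary_of_vanishing (c : Γ × Γ → ℝ)
    (hc : ∀ z : groupHomology.cycles₂ (triv Γ ℤ), chainPairing c z.1 = 0) :
    ∃ u : Γ → ℝ, ∀ g h, c (g, h) = u h - u (g * h) + u g := by
  let d : (Γ × Γ →₀ ℤ) →ₗ[ℤ] (Γ →₀ ℤ) := (groupHomology.d₂₁ (triv Γ ℤ)).hom
  let F : (Γ × Γ →₀ ℤ) →ₗ[ℤ] ℝ := (chainPairing c).toIntLinearMap
  have hF : LinearMap.ker d.rangeRestrict ≤ LinearMap.ker F := by
    rw [LinearMap.ker_rangeRestrict]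
    exact fun z hz => hc ⟨z, hz⟩
  let f : LinearMap.range d →ₗ[ℤ] ℝ :=
    (LinearMap.ker d.rangeRestrict).liftQ F hF ∘ₗ
      (d.rangeRestrict.quotKerEquivOfSurjective d.surjective_rangeRestrict).symm.toLinearMap
  have hf : ∀ y, f (d.rangeRestrict y) = F y := fun y => by
    have : (d.rangeRestrict.quotKerEquivOfSurjective d.surjective_rangeRestrict).symm
        (d.rangeRestrict y) = Submodule.Quotient.mk y :=
      (LinearEquiv.symm_apply_eq _).2 rfl
    change (LinearMap.ker d.rangeRestrict).liftQ F hF _ = _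
    rw [LinearEquiv.coe_coe, this, Submodule.liftQ_apply]
  -- The pairing descends to `f` on `1`-boundaries; injectivity of `ℝ` as a `ℤ`-module extends it to
  -- all `1`-chains, and `u` is its restriction to the basis.
  obtain ⟨U, hU⟩ := (Module.Baer.of_divisible ℝ).extension_property
    (LinearMap.range d).subtype Subtype.val_injective f
  refine ⟨fun g => U (Finsupp.single g 1), fun g h => ?_⟩
  have h1 : U (d (Finsupp.single (g, h) 1)) = c (g, h) := by
    refine (LinearMap.congr_fun hU (d.rangeRestrict (Finsupp.single (g, h) 1))).trans ?_
    rw [hf]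
    exact (chainPairing_single c _ _).trans (one_smul _ _)
  have h2 : d (Finsupp.single (g, h) 1) =
      Finsupp.single h 1 - Finsupp.single (g * h) 1 + Finsupp.single g 1 :=
    groupHomology.d₂₁_single (A := triv Γ ℤ) (g, h) 1
  rw [← h1, h2, map_add, map_sub]

end UniversalCoefficients

/-! ### Change of coefficients and classes with prescribed evaluation -/

section CoefficientMap

variable {Γ : Type} [Group Γ] {M N : Type} [AddCommGroup M] [AddCommGroup N]

/-- Postcomposition of a cocycle with a homomorphism of coefficients. -/
def mapCocycle (f : M →+ N) (c : groupCohomology.cocycles₂ (triv Γ M)) :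
    groupCohomology.cocycles₂ (triv Γ N) :=
  ⟨fun p => f (c p), (groupCohomology.mem_cocycles₂_iff (A := triv Γ N) _).2 fun g h k => by
    have := congrArg f ((groupCohomology.mem_cocycles₂_iff c.1).1 c.2 g h k)
    exact (map_add f _ _).symm.trans (this.trans (map_add f _ _))⟩

/-- The coefficient map is computed on representatives. -/
lemma coeffMap_H2π (f : M →+ N) (c : groupCohomology.cocycles₂ (triv Γ M)) :
    coeffMap f (groupCohomology.H2π (triv Γ M) c) =
      groupCohomology.H2π (triv Γ N) (mapCocycle f c) :=
  groupCohomology.H2π_comp_map_apply (MonoidHom.id Γ) _ c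

/-- Evaluation is natural in the coefficients. -/
lemma kroneckerEval_coeffMap (f : M →+ N) (φ : Hup₂ Γ M) (x : H₂ Γ) :
    kroneckerEval (coeffMap f φ) x = f (kroneckerEval φ x) := by
  obtain ⟨c, rfl⟩ := cohomologyπ_surjective φ
  obtain ⟨z, rfl⟩ := homologyπ_surjective x
  refine (DFunLike.congr_fun (congrArg kroneckerEval (coeffMap_H2π f c)) _).trans ?_
  refine (kroneckerEval_apply _ z).trans ?_
  refine Eq.trans ?_ (congrArg f (kroneckerEval_apply c z)).symm
  rw [map_finsuppSum]
  exact Finsupp.sum_congr fun p _ => (map_zsmul f _ _).symm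

lemma coeffMap_coeffMap_of_rightInverse {f : M →+ N} {s : N →+ M}
    (hs : Function.RightInverse s f) (φ : Hup₂ Γ N) : coeffMap f (coeffMap s φ) = φ := by
  obtain ⟨c, rfl⟩ := cohomologyπ_surjective φ
  refine (congrArg (coeffMap f) (coeffMap_H2π s c)).trans ((coeffMap_H2π f _).trans ?_)
  exact congrArg _ (Subtype.ext (funext fun p => hs (c p)))

/-- If `ε` is onto `ℤ`, every homomorphism `θ : H_2(Γ; ℤ) → M` is the evaluation of a class with
a prescribed compatible image in `H^2(Γ; ℤ)`. -/
theorem exists_coeffMap_eq_and_kroneckerEval_eq [Module.Finite ℤ (H₁ Γ)] {ε : M →+ ℤ}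
    (hε : Function.Surjective ε) (η : Hup₂ Γ ℤ) (θ : H₂ Γ →+ M)
    (h : ∀ x, ε (θ x) = kroneckerEval η x) :
    ∃ φ : Hup₂ Γ M, coeffMap ε φ = η ∧ kroneckerEval φ = θ := by
  obtain ⟨a, ha⟩ := hε 1
  let s : ℤ →+ M := zmultiplesHom M a
  have hs : Function.RightInverse s ε := fun n => by simp [s, ha]
  obtain ⟨φ₀, hφ₀⟩ := kroneckerEval_surjective θ
  -- By `h`, the error `coeffMap ε φ₀ - η` evaluates to zero, so subtracting its image under `s`
  -- repairs the coefficient image without altering the evaluation.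
  refine ⟨φ₀ - coeffMap s (coeffMap ε φ₀ - η), ?_, ?_⟩
  · rw [map_sub, coeffMap_coeffMap_of_rightInverse hs, sub_sub_cancel]
  · ext x
    rw [map_sub, AddMonoidHom.sub_apply, kroneckerEval_coeffMap, map_sub, AddMonoidHom.sub_apply,
      kroneckerEval_coeffMap, hφ₀, h, sub_self, map_zero, sub_zero]

end CoefficientMap

/-! ### Homomorphisms between central extensions -/

section ExtensionMap

variable {Γ : Type} [Group Γ] {M N : Type} [AddCommGroup M] [AddCommGroup N]
  {E E' : Type*} [Group E] [Group E']

/-- A homomorphism of coefficients that carries the class of one central extension to that of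
another extends to a homomorphism of extensions over `Γ`. -/
theorem exists_extension_hom {S : GroupExtension (Multiplicative M) E Γ}
    {T : GroupExtension (Multiplicative N) E' Γ} {φ : Hup₂ Γ M} {η : Hup₂ Γ N}
    (hS : HasClass S φ) (hT : HasClass T η) {f : M →+ N} (hf : coeffMap f φ = η) :
    ∃ ψ : E →* E', (∀ x : M, ψ (S.inl (Multiplicative.ofAdd x)) =
        T.inl (Multiplicative.ofAdd (f x))) ∧ ∀ e, T.rightHom (ψ e) = S.rightHom e := by
  obtain ⟨hSc, s, c, rfl, hs⟩ := hS
  obtain ⟨hTc, t, c', rfl, ht⟩ := hT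
  -- Equality of classes gives a cochain `u` with `f ∘ c - c' = du`; it will correct the naive map
  -- `x · s(g) ↦ f(x) · t(g)`.
  obtain ⟨u, hu⟩ := (groupCohomology.H2π_eq_iff _ _).1 ((coeffMap_H2π f c).symm.trans hf)
  have hu' : ∀ g h, f (c (g, h)) + u (g * h) = u g + u h + c' (g, h) := fun g h => by
    have h1 : u h - u (g * h) + u g = f (c (g, h)) - c' (g, h) := congrFun hu (g, h)
    rw [eq_sub_iff_add_eq] at h1
    rw [← h1]; abel
  have hSr : ∀ g, S.rightHom (s g) = g := s.rightInverse_rightHom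
  have hTr : ∀ g, T.rightHom (t g) = g := t.rightInverse_rightHom
  have key : ∀ e : E, ∃ x : M, e = S.inl (Multiplicative.ofAdd x) * s (S.rightHom e) := fun e => by
    have : e * (s (S.rightHom e))⁻¹ ∈ S.inl.range := by
      rw [S.range_inl_eq_ker_rightHom, MonoidHom.mem_ker, map_mul, map_inv, hSr, mul_inv_cancel]
    obtain ⟨x, hx⟩ := this
    exact ⟨x.toAdd, by rw [ofAdd_toAdd, hx, inv_mul_cancel_right]⟩
  choose a ha using key
  have ha_mul : ∀ x y, a (x * y) = a x + a y + c (S.rightHom x, S.rightHom y) := fun x y => by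
    have hcen := Subgroup.mem_center_iff.1 (hSc ⟨Multiplicative.ofAdd (a y), rfl⟩)
      (s (S.rightHom x))
    have h1 : S.inl (Multiplicative.ofAdd (a (x * y))) * s (S.rightHom (x * y)) =
        S.inl (Multiplicative.ofAdd (a x + a y + c (S.rightHom x, S.rightHom y))) *
          s (S.rightHom (x * y)) := by
      rw [← ha (x * y), ofAdd_add, ofAdd_add, map_mul, map_mul, map_mul S.rightHom, mul_assoc _ _
        (s _), ← hs]
      conv_lhs => rw [ha x, ha y]
      rw [mul_assoc, ← mul_assoc (s _), hcen]
      simp only [mul_assoc]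
    exact Multiplicative.ofAdd.injective (S.inl_injective (mul_right_cancel h1))
  -- The section need not send `1` to `1`, whence the offset `a 1`.
  have ha_inl : ∀ x : M, a (S.inl (Multiplicative.ofAdd x)) = x + a 1 := fun x => by
    have h1 := ha (S.inl (Multiplicative.ofAdd x))
    have h2 : S.inl (Multiplicative.ofAdd x) =
        S.inl (Multiplicative.ofAdd (x + a 1)) * s (S.rightHom 1) := by
      rw [ofAdd_add, map_mul, mul_assoc, ← ha 1, mul_one]
    rw [S.rightHom_inl] at h1
    rw [map_one] at h2
    exact Multiplicative.ofAdd.injective (S.inl_injective (mul_right_cancel (h1.symm.trans h2)))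
  let ψ : E →* E' := MonoidHom.mk'
    (fun e => T.inl (Multiplicative.ofAdd (f (a e) + u (S.rightHom e))) * t (S.rightHom e))
    fun x y => by
      have hcen := Subgroup.mem_center_iff.1
        (hTc ⟨Multiplicative.ofAdd (f (a y) + u (S.rightHom y)), rfl⟩) (t (S.rightHom x))
      have h1 : f (a (x * y)) + u (S.rightHom (x * y)) =
          (f (a x) + u (S.rightHom x)) + (f (a y) + u (S.rightHom y)) +
            c' (S.rightHom x, S.rightHom y) := by
        rw [ha_mul, map_add, map_add, map_mul, add_assoc, hu']; abel
      rw [h1, ofAdd_add, ofAdd_add, map_mul, map_mul, map_mul S.rightHom, mul_assoc _ _ (t _), ← ht,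
        mul_assoc (T.inl _) (t _), ← mul_assoc (t _) (T.inl _), hcen]
      simp only [mul_assoc]
  refine ⟨ψ, fun x => ?_, fun e => ?_⟩
  -- The offsets from the unnormalized `s`, `t` and `u` combine to the factor `ψ 1`, which is
  -- trivial.
  · have h1 : ψ 1 = 1 := map_one ψ
    change T.inl (Multiplicative.ofAdd (f (a (S.inl _)) + u (S.rightHom (S.inl _)))) *
      t (S.rightHom (S.inl _)) = _
    change T.inl (Multiplicative.ofAdd (f (a 1) + u (S.rightHom 1))) * t (S.rightHom 1) = 1 at h1
    rw [ha_inl, S.rightHom_inl, map_add f, add_assoc, ofAdd_add, map_mul, mul_assoc]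
    rw [map_one] at h1
    rw [h1, mul_one]
  · change T.rightHom (T.inl _ * t (S.rightHom e)) = _
    rw [map_mul, T.rightHom_inl, one_mul, hTr]

/-- A homomorphism of extensions over `Γ` that is onto on the kernels is onto. -/
lemma surjective_of_surjective_inl {K L G : Type*} [Group K] [Group L] [Group G]
    {S : GroupExtension K E G} {T : GroupExtension L E' G} {ψ : E →* E'} {f : K → L}
    (hf : Function.Surjective f) (hinl : ∀ x, ψ (S.inl x) = T.inl (f x))
    (hr : ∀ e, T.rightHom (ψ e) = S.rightHom e) : Function.Surjective ψ := by
  intro y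
  obtain ⟨e, he⟩ := S.rightHom_surjective (T.rightHom y)
  have : y * (ψ e)⁻¹ ∈ T.inl.range := by
    rw [T.range_inl_eq_ker_rightHom, MonoidHom.mem_ker, map_mul, map_inv, hr, he, mul_inv_cancel]
  obtain ⟨l, hl⟩ := this
  obtain ⟨k, rfl⟩ := hf l
  exact ⟨S.inl k * e, by rw [map_mul, hinl, hl, inv_mul_cancel_right]⟩

end ExtensionMap

/-! ### Non-vanishing of the Euler class evaluation -/

section EulerEvaluation

variable {Γ : Type} [Group Γ]

/-- If every quasi-morphism is trivial, the comparison map is injective: a bounded cocycle that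
is a coboundary is the coboundary of a bounded cochain. -/
lemma mem_boundedCoboundaries
    (hqm : ∀ f : Γ → ℝ, IsQuasimorphism f → IsTrivialQuasimorphism f)
    {c : Γ × Γ → ℝ} (hc : c ∈ boundedFun (Γ × Γ)) {u : Γ → ℝ}
    (hu : ∀ g h, c (g, h) = u h - u (g * h) + u g) : c ∈ boundedCoboundaries Γ := by
  obtain ⟨D, hD⟩ := hc
  -- Up to sign, the defect of `u` is its coboundary `c`, so boundedness of `c` makes `u` a
  -- quasi-morphism.
  obtain ⟨χ, D', hD'⟩ := hqm u ⟨D, fun g h => by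
    have := hD (g, h)
    rw [hu, ← abs_neg] at this
    convert this using 2
    ring⟩
  refine ⟨fun g => u g - (χ g).toAdd, ⟨D', hD'⟩, funext fun p => ?_⟩
  obtain ⟨g, h⟩ := p
  change (u h - (χ h).toAdd) - (u (g * h) - (χ (g * h)).toAdd) + (u g - (χ g).toAdd) = c (g, h)
  rw [hu, map_mul, toAdd_mul]
  ring

variable (ρ : Γ →* (UnitAddCircle ≃ₜ UnitAddCircle)) (hρ : ∀ g, OrientationPreserving (ρ g))

/-- If every quasi-morphism is trivial and the bounded Euler class does not vanish, then the
Euler class evaluates non-trivially. -/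
theorem kroneckerEval_eulerClass_ne_zero
    (hqm : ∀ f : Γ → ℝ, IsQuasimorphism f → IsTrivialQuasimorphism f)
    (hne : boundedEulerClass ρ hρ ≠ 0) : kroneckerEval (eulerClass ρ hρ) ≠ 0 := by
  intro h0
  obtain ⟨u, hu⟩ := exists_eq_coboundary_of_vanishing (fun p => (eulerFun ρ hρ p : ℝ)) fun z => by
    have h1 : (z.1.sum fun p n => n • eulerFun ρ hρ p) = 0 :=
      (kroneckerEval_apply (eulerCocycle ρ hρ) z).symm.trans (DFunLike.congr_fun h0 _)
    have h2 := congrArg (Int.castAddHom ℝ) h1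
    rw [map_finsuppSum, map_zero] at h2
    change (z.1.sum fun p n => n • (eulerFun ρ hρ p : ℝ)) = 0
    refine Eq.trans (Finsupp.sum_congr fun p _ => ?_) h2
    exact (map_zsmul (Int.castAddHom ℝ) _ _).symm
  exact hne ((Submodule.Quotient.mk_eq_zero _).2
    (mem_boundedCoboundaries hqm (boundedEulerCocycle ρ hρ).2.2 hu))

end EulerEvaluation

end EulerExt

/-! ### The main theorem -/

theorem proposition3p4 (Γ : Type) [Group Γ]
    (ρ : Γ →* (UnitAddCircle ≃ₜ UnitAddCircle))
    (hρ : ∀ g, OrientationPreserving (ρ g))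
    (hfp : Group.IsFinitelyPresented Γ)
    (hH₁ : Finite (H₁ Γ))
    (hqm : ∀ f : Γ → ℝ, IsQuasimorphism f → IsTrivialQuasimorphism f)
    (hHb : Nonempty (Hb₂ Γ ≃ₗ[ℝ] ℝ))
    (hgen : Submodule.span ℝ {boundedEulerClass ρ hρ} = ⊤) :
    kroneckerEval (eulerClass ρ hρ) ≠ 0 ∧
    ∀ m : ℕ, 0 < m →
      (kroneckerEval (eulerClass ρ hρ)).range = AddSubgroup.zmultiples (m : ℤ) →
      ∃ ε : H₂ Γ →+ ℤ, (∀ x, (m : ℤ) * ε x = kroneckerEval (eulerClass ρ hρ) x) ∧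
        (∃ φ : Hup₂ Γ (H₂ Γ),
          coeffMap ε φ = eulerClass ρ hρ ∧ kroneckerEval φ = m • AddMonoidHom.id (H₂ Γ)) ∧
        (∀ φ : Hup₂ Γ (H₂ Γ),
          coeffMap ε φ = eulerClass ρ hρ → kroneckerEval φ = m • AddMonoidHom.id (H₂ Γ) →
          ∀ (E : Type*) [Group E] (S : GroupExtension (Multiplicative (H₂ Γ)) E Γ)
            (Γt : Type*) [Group Γt] (T : GroupExtension (Multiplicative ℤ) Γt Γ),
            HasClass S φ → HasClass T (eulerClass ρ hρ) →
            ∃ ψ : E →* Γt, Function.Surjective ψ ∧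
              (∀ x : H₂ Γ, ψ (S.inl (Multiplicative.ofAdd x)) =
                T.inl (Multiplicative.ofAdd (ε x))) ∧
              ψ.ker ≤ S.inl.range) := by
  have hfin : Module.Finite ℤ (H₁ Γ) := inferInstance
  have hne : boundedEulerClass ρ hρ ≠ 0 := fun h => by
    obtain ⟨e⟩ := hHb
    have : Nontrivial (Hb₂ Γ) := e.toEquiv.nontrivial
    rw [h, Submodule.span_zero_singleton] at hgen
    exact bot_ne_top hgen
  refine ⟨kroneckerEval_eulerClass_ne_zero ρ hρ hqm hne, fun m hm hrange => ?_⟩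
  have hm' : (m : ℤ) ≠ 0 := by exact_mod_cast hm.ne'
  have hdvd : ∀ x, (m : ℤ) ∣ kroneckerEval (eulerClass ρ hρ) x := fun x =>
    Int.mem_zmultiples_iff.1 (hrange ▸ ⟨x, rfl⟩)
  let ε : H₂ Γ →+ ℤ := AddMonoidHom.mk' (fun x => kroneckerEval (eulerClass ρ hρ) x / m)
    fun x y => by rw [map_add, Int.add_ediv_of_dvd_left (hdvd x)]
  have hε : ∀ x, (m : ℤ) * ε x = kroneckerEval (eulerClass ρ hρ) x := fun x =>
    Int.mul_ediv_cancel' (hdvd x)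
  -- That `m` generates the image, rather than merely dividing it, makes `ε` onto; both the
  -- splitting of `ε` and the surjectivity of `ψ` rest on this.
  have hεsurj : Function.Surjective ε := fun n => by
    obtain ⟨x, hx⟩ : (n * m : ℤ) ∈ (kroneckerEval (eulerClass ρ hρ)).range :=
      hrange ▸ Int.mem_zmultiples_iff.2 (Dvd.intro_left n rfl)
    exact ⟨x, mul_left_cancel₀ hm' (by rw [hε, hx, mul_comm])⟩
  refine ⟨ε, hε, ?_, ?_⟩
  · refine exists_coeffMap_eq_and_kroneckerEval_eq hεsurj _ _ fun x => ?_
    rw [← hε x, AddMonoidHom.smul_apply, map_nsmul, nsmul_eq_mul, AddMonoidHom.id_apply]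
  · intro φ hφ _ E _ S Γt _ T hS hT
    obtain ⟨ψ, hψ, hr⟩ := exists_extension_hom hS hT hφ
    refine ⟨ψ, surjective_of_surjective_inl (f := fun x => Multiplicative.ofAdd (ε x.toAdd))
      (fun n => ?_) (fun x => hψ x.toAdd) hr, hψ, fun e he => ?_⟩
    · obtain ⟨x, hx⟩ := hεsurj n.toAdd
      exact ⟨Multiplicative.ofAdd x, congrArg Multiplicative.ofAdd hx⟩
    · rw [S.range_inl_eq_ker_rightHom, MonoidHom.mem_ker, ← hr, MonoidHom.mem_ker.1 he, map_one]
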